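/- Let $H$ be a real Hilbert space with identity map $\mathbf 1$. An operator $A$ on $H$ is a map $A\colon H\to 2^H$ with graph $\{(f,g): g\in A(f)\}$ and domain $\operatorname{dom}A=\{f: A(f)\ne\emptyset\}$. It is monotone if $\langle g_1-g_2,f_1-f_2\rangle\ge 0$ whenever $g_i\in A(f_i)$, and maximal monotone if it is monotone and its graph is not properly contained in the graph of another monotone operator. For a non-empty closed convex set $C\subset H$ let $P_C$ be the nearest-point projection onto $C$. A family of maps $J_\lambda\colon H\to H$, $\lambda\ge 0$, is a strongly continuous non-expansive non-linear resolvent on $C$ if - $J_0=P_C$; - $J_\lambda=J_\mu\circ\big(\tfrac{\mu}{\lambda}\mathbf 1+(1-\tfrac{\mu}{\lambda})J_\lambda\big)$ for all $\lambda>0$, $\mu\ge0$; - $\lim_{\lambda\downarrow0}\|J_\lambda(f)-P_C(f)\|=0$ for all $f\in H$; - $\|J_\lambda(f)-J_\lambda(g)\|\le\|f-g\|$ for all $f,g\in H$, $\lambda\ge0$. A family of operators $A_\lambda$, $\lambda>0$, graph-converges to $A$ as $\lambda\downarrow0$, written $A=\mathrm{Gph}\text{-}\lim_{\lambda\downarrow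 0}A_\lambda$, if the graphs converge in the sense of Painlevé–Kuratowski, that is, if the outer limit $\{x\in H\times H:\liminf_{\lambda\downarrow0}d(x,\operatorname{graph}A_\lambda)=0\}$ and the inner limit $\{x\in H\times H:\limsup_{\lambda\downarrow0}d(x,\operatorname{graph}A_\lambda)=0\}$ both equal the graph of $A$. **Theorem.** Let $C\subset H$ and let $J_\lambda\colon H\to H$, $\lambda\ge0$, be a family of maps. The following are equivalent: 1. $C$ is non-empty, closed and convex, and $(J_\lambda)_{\lambda\ge0}$ is a strongly continuous non-expansive non-linear resolvent on $C$. 2. The graph limit $A=\mathrm{Gph}\text{-}\lim_{\lambda\downarrow0}\tfrac1\lambda(\mathbf 1-J_\lambda)$ exists and is a maximal monotone operator, $J_\lambda=(\mathbf 1+\lambda A)^{-1}$ for every $\lambda>0$, $C=\overline{\operatorname{dom}A}$, and, for every $f\in H$, $J_0(f)$ is a point of $C$ closest to $f$ (that is, $J_0=P_C$). -/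

import Mathlib

open Filter Topology
open scoped NNReal ENNReal

namespace NonlinearResolvent

section PainleveKuratowski

variable {ι X : Type*} [PseudoEMetricSpace X]

/-- The outer limit, along the filter `l`, of a family of sets: the points `x` with
`liminf d(x, S i) = 0`. The distance to the empty set is `∞`. -/
def outerLimit (l : Filter ι) (S : ι → Set X) : Set X :=
  {x | liminf (fun i => Metric.infEDist x (S i)) l = 0}

/-- The inner limit, along the filter `l`, of a family of sets: the points `x` with
`limsup d(x, S i) = 0`. -/
def innerLimit (l : Filter ι) (S : ι → Set X) : Set X :=
  {x | limsup (fun i => Metric.infEDist x (S i)) l = 0}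

/-- The family of sets `S` converges to `L` in the sense of Painlevé and Kuratowski along `l`:
the outer and the inner limit agree and are equal to `L`. -/
def PKTendsto (S : ι → Set X) (l : Filter ι) (L : Set X) : Prop :=
  outerLimit l S = L ∧ innerLimit l S = L

end PainleveKuratowski

/-- A multi-valued operator on `H`, that is, a map from `H` to the subsets of `H`. -/
abbrev MultiOp (H : Type*) := H → Set H

section Operators

variable {H : Type*} [NormedAddCommGroup H] [InnerProductSpace ℝ H]

/-- The domain of an operator. -/
def MultiOp.dom (A : MultiOp H) : Set H := {f | (A f).Nonempty}

/-- The graph of an operator. -/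
def MultiOp.graph (A : MultiOp H) : Set (H × H) := {p | p.2 ∈ A p.1}

/-- The inverse of an operator: `f ∈ A⁻¹ g` iff `g ∈ A f`. -/
def MultiOp.inverse (A : MultiOp H) : MultiOp H := fun g => {f | g ∈ A f}

/-- The operator `1 + c A`. -/
def MultiOp.idAddSMul (c : ℝ) (A : MultiOp H) : MultiOp H :=
  fun f => (fun g => f + c • g) '' A f

/-- A map, seen as a single-valued operator. -/
def MultiOp.ofFun (T : H → H) : MultiOp H := fun f => {T f}

/-- Monotone operators. -/
def MultiOp.IsMonotone (A : MultiOp H) : Prop :=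
  ∀ f₁ f₂ g₁ g₂ : H, g₁ ∈ A f₁ → g₂ ∈ A f₂ → 0 ≤ inner ℝ (g₁ - g₂) (f₁ - f₂)

/-- Maximal monotone operators: monotone, and maximal among the monotone operators with respect
to the inclusion of graphs. -/
def MultiOp.IsMaximalMonotone (A : MultiOp H) : Prop :=
  A.IsMonotone ∧ ∀ B : MultiOp H, B.IsMonotone → A.graph ⊆ B.graph → B.graph ⊆ A.graph

/-- Graph convergence of a family of operators: Painlevé-Kuratowski convergence of the graphs in
`H × H`. (The maximum metric on `H × H` is Lipschitz equivalent to the Hilbert one, so that both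
have the same outer and inner limits.) -/
def GraphTendsto {ι : Type*} (A : ι → MultiOp H) (l : Filter ι) (B : MultiOp H) : Prop :=
  PKTendsto (fun i => (A i).graph) l B.graph

/-- `p` is a point of `C` closest to `f`. If `C` is non-empty, closed and convex and `H` is
complete, there is exactly one such point, the projection `P_C f`. -/
def IsProjection (C : Set H) (f p : H) : Prop :=
  p ∈ C ∧ ∀ q ∈ C, ‖f - p‖ ≤ ‖f - q‖

/-- `J` is a strongly continuous non-expansive non-linear resolvent on the non-empty closed convex
set `C`. -/
structure IsResolvent (C : Set H) (J : ℝ≥0 → H → H) : Prop where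
  nonempty : C.Nonempty
  isClosed : IsClosed C
  convex : Convex ℝ C
  /-- `J_0 = P_C`. -/
  identity : ∀ f, IsProjection C f (J 0 f)
  /-- The first resolvent identity; the case `μ = 0` is included. -/
  resolvent_identity : ∀ l m : ℝ≥0, 0 < l → ∀ f,
    J l f = J m (((m : ℝ) / l) • f + (1 - (m : ℝ) / l) • J l f)
  /-- `J_λ f → P_C f` as `λ ↓ 0`. -/
  strong_continuity : ∀ f p, IsProjection C f p →
    Tendsto (fun l : ℝ≥0 => ‖J l f - p‖) (𝓝[>] 0) (𝓝 0)
  nonexpansive : ∀ (l : ℝ≥0) (f g : H), ‖J l f - J l g‖ ≤ ‖f - g‖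

/-- The operator `A_λ = λ⁻¹ (1 - J_λ)`, for `λ > 0`. -/
def approxGenerator (J : ℝ≥0 → H → H) (l : ℝ≥0) : MultiOp H :=
  MultiOp.ofFun fun f => (l : ℝ)⁻¹ • (f - J l f)

end Operators

end NonlinearResolvent

namespace NonlinearResolvent

section

variable {H : Type*} [NormedAddCommGroup H] [InnerProductSpace ℝ H]

/-- The inner and the outer limit of `S` are both `L` as soon as `d(x, S i) → 0` for the points
`x` of `L`, and `L` contains the outer limit. -/
theorem pkTendsto_of_subset {ι X : Type*} [PseudoEMetricSpace X] {l : Filter ι} [l.NeBot]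
    {S : ι → Set X} {L : Set X}
    (h₁ : ∀ x ∈ L, Tendsto (fun i => Metric.infEDist x (S i)) l (𝓝 0))
    (h₂ : outerLimit l S ⊆ L) : PKTendsto S l L := by
  have h₃ : innerLimit l S ⊆ outerLimit l S := fun x hx =>
    le_antisymm ((liminf_le_limsup (u := fun i => Metric.infEDist x (S i))).trans (le_of_eq hx))
      bot_le
  exact ⟨h₂.antisymm fun x hx => (h₁ x hx).liminf_eq,
    (h₃.trans h₂).antisymm fun x hx => (h₁ x hx).limsup_eq⟩

theorem IsProjection.eq_self {C : Set H} {f p : H} (h : IsProjection C f p) (hf : f ∈ C) :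
    p = f := by
  have := h.2 f hf
  rw [sub_self, norm_zero, norm_le_zero_iff, sub_eq_zero] at this
  exact this.symm

theorem IsProjection.inner_le_zero {C : Set H} (hC : Convex ℝ C) {f p : H}
    (h : IsProjection C f p) {w : H} (hw : w ∈ C) : inner ℝ (f - p) (w - p) ≤ 0 := by
  refine (norm_eq_iInf_iff_real_inner_le_zero hC h.1).1 (le_antisymm ?_ ?_) w hw
  · have : Nonempty C := ⟨⟨p, h.1⟩⟩
    exact le_ciInf fun q => h.2 q q.2
  · exact ciInf_le (f := fun q : C => ‖f - q‖)
      ⟨0, by rintro _ ⟨q, rfl⟩; exact norm_nonneg _⟩ ⟨p, h.1⟩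

theorem norm_le_of_sq_le_inner {u v : H} (h : inner ℝ u u ≤ inner ℝ v u) : ‖u‖ ≤ ‖v‖ := by
  have h₁ := real_inner_le_norm v u
  rw [real_inner_self_eq_norm_sq] at h
  by_contra! h₂
  nlinarith [norm_nonneg v]

theorem IsProjection.norm_sub_le {C : Set H} (hC : Convex ℝ C) {f g p q : H}
    (hp : IsProjection C f p) (hq : IsProjection C g q) : ‖p - q‖ ≤ ‖f - g‖ := by
  apply norm_le_of_sq_le_inner
  have h₁ := hp.inner_le_zero hC hq.1
  have h₂ := hq.inner_le_zero hC hp.1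
  simp only [inner_sub_left, inner_sub_right] at *
  linarith

/-- The resolvents `(1 + c A)⁻¹`, `c ≥ 0`, of a monotone operator are non-expansive. -/
theorem MultiOp.IsMonotone.norm_sub_le {A : MultiOp H} (hA : A.IsMonotone) {c : ℝ} (hc : 0 ≤ c)
    {x y g h : H} (hx : g ∈ A x) (hy : h ∈ A y) : ‖x - y‖ ≤ ‖(x + c • g) - (y + c • h)‖ := by
  apply norm_le_of_sq_le_inner
  have h₁ := mul_nonneg hc (hA x y g h hx hy)
  rw [show (x + c • g) - (y + c • h) = (x - y) + c • (g - h) by module, inner_add_left,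
    real_inner_smul_left]
  linarith

/-- A monotone operator `A` for which `1 + A` is onto is maximal monotone. -/
theorem MultiOp.IsMonotone.isMaximalMonotone {A : MultiOp H} (hA : A.IsMonotone)
    (h : ∀ f, ∃ x, f - x ∈ A x) : A.IsMaximalMonotone := by
  refine ⟨hA, fun B hB hAB => ?_⟩
  rintro ⟨x, g⟩ hg
  obtain ⟨y, hy⟩ := h (x + g)
  have h₁ := hB x y g (x + g - y) hg (hAB (a := (y, x + g - y)) hy)
  rw [show g - (x + g - y) = -(x - y) by abel, inner_neg_left, real_inner_self_eq_norm_sq] at h₁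
  have h₂ : x = y := by
    rw [← sub_eq_zero, ← norm_eq_zero]
    nlinarith [norm_nonneg (x - y)]
  subst h₂
  rwa [add_sub_cancel_left] at hy

/-- The points `z` at which the affine functions `⟪b, · - a⟫`, `(a, b)` in the graph of `A`, are
bounded by an affine function of `a`. -/
def MultiOp.affineDom (A : MultiOp H) : Set H :=
  {z | ∃ (y : H) (c : ℝ), ∀ a, ∀ b ∈ A a, inner ℝ b (z - a) ≤ c - inner ℝ y a}

theorem MultiOp.convex_affineDom (A : MultiOp H) : Convex ℝ A.affineDom := by
  rintro z ⟨y, c, hz⟩ z' ⟨y', c', hz'⟩ s t hs ht hst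
  refine ⟨s • y + t • y', s * c + t * c', fun a b hb => ?_⟩
  have h₁ := mul_le_mul_of_nonneg_left (hz a b hb) hs
  have h₂ := mul_le_mul_of_nonneg_left (hz' a b hb) ht
  obtain rfl : t = 1 - s := by linarith
  rw [show s • z + (1 - s) • z' - a = s • (z - a) + (1 - s) • (z' - a) by module]
  simp only [inner_add_left, inner_add_right, real_inner_smul_left, real_inner_smul_right]
  linarith

theorem MultiOp.IsMonotone.dom_subset_affineDom {A : MultiOp H} (hA : A.IsMonotone) :
    A.dom ⊆ A.affineDom := by
  rintro x ⟨y, hy⟩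
  refine ⟨y, inner ℝ y x, fun a b hb => ?_⟩
  have := hA x a y b hy hb
  simp only [inner_sub_left, inner_sub_right] at *
  linarith

/-- If `u l = (1 + l A)⁻¹ f` for a monotone operator `A`, then `u l` converges, as `l ↓ 0`, to the
projection of `f` onto the closed convex hull of the domain of `A`. -/
theorem MultiOp.IsMonotone.tendsto_resolvent {A : MultiOp H} (hA : A.IsMonotone) {f p : H}
    {u : ℝ≥0 → H} (hu : ∀ l, 0 < l → (l : ℝ)⁻¹ • (f - u l) ∈ A (u l))
    (hp : p ∈ closure (convexHull ℝ A.dom)) (hfp : ∀ w ∈ A.dom, inner ℝ (f - p) (w - p) ≤ 0) :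
    Tendsto (fun l => ‖u l - p‖) (𝓝[>] 0) (𝓝 0) := by
  set x₀ := u 1
  set y₀ := ((1 : ℝ≥0) : ℝ)⁻¹ • (f - x₀)
  have h₀ : y₀ ∈ A x₀ := hu 1 one_pos
  set K := 2 * ‖f - x₀‖ + ‖y₀‖
  have hK : 0 ≤ K := by positivity
  have hbound : ∀ l : ℝ≥0, 0 < l → l ≤ 1 → ‖f - u l‖ ≤ K := by
    intro l hl hl1
    have h₁ := hA.norm_sub_le l.coe_nonneg (hu l hl) h₀
    have hl' : (l : ℝ) ≠ 0 := by exact_mod_cast hl.ne'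
    rw [smul_inv_smul₀ hl', add_sub_cancel,
      show f - (x₀ + (l : ℝ) • y₀) = (f - x₀) - (l : ℝ) • y₀ by abel] at h₁
    have h₂ : ‖(f - x₀) - (l : ℝ) • y₀‖ ≤ ‖f - x₀‖ + ‖y₀‖ := by
      refine (_root_.norm_sub_le _ _).trans ?_
      rw [norm_smul, Real.norm_of_nonneg l.coe_nonneg]
      have : (l : ℝ) ≤ 1 := hl1
      nlinarith [norm_nonneg y₀]
    have h₃ : ‖f - u l‖ ≤ ‖f - x₀‖ + ‖u l - x₀‖ := by
      rw [show f - u l = (f - x₀) - (u l - x₀) by abel]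
      exact _root_.norm_sub_le _ _
    linarith
  rw [Metric.tendsto_nhds]
  intro ε hε
  obtain ⟨z, hz, hpz⟩ := Metric.mem_closure_iff.1 hp (ε ^ 2 / (2 * (K + 1))) (by positivity)
  obtain ⟨y, c, hyc⟩ := convexHull_min hA.dom_subset_affineDom A.convex_affineDom hz
  set M := |c| + ‖y‖ * (‖f‖ + K)
  have hM : Tendsto (fun l : ℝ≥0 => (l : ℝ) * M) (𝓝[>] 0) (𝓝 0) := by
    have : Continuous fun l : ℝ≥0 => (l : ℝ) * M := by fun_prop
    simpa using (this.tendsto 0).mono_left nhdsWithin_le_nhds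
  filter_upwards [hM.eventually_lt_const (show 0 < ε ^ 2 / 2 by positivity),
    self_mem_nhdsWithin, nhdsWithin_le_nhds (Iic_mem_nhds (zero_lt_one (α := ℝ≥0)))]
    with l hlM hl hl1
  replace hl : 0 < l := hl
  have hl' : (0 : ℝ) < l := hl
  have h₁ := hfp (u l) ⟨_, hu l hl⟩
  have h₂ := mul_le_mul_of_nonneg_left (hyc _ _ (hu l hl)) hl'.le
  rw [real_inner_smul_left, mul_inv_cancel_left₀ hl'.ne'] at h₂
  have hb := hbound l hl hl1
  have h₃ : c - inner ℝ y (u l) ≤ M := by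
    have h₄ := abs_le.1 (abs_real_inner_le_norm y (u l))
    have h₅ : ‖u l‖ ≤ ‖f‖ + K := by
      have := _root_.norm_sub_le f (f - u l)
      rw [sub_sub_cancel] at this
      linarith
    have := mul_le_mul_of_nonneg_left h₅ (norm_nonneg y)
    linarith [le_abs_self c, h₄.1]
  have h₆ := mul_le_mul_of_nonneg_left h₃ hl'.le
  have h₇ : inner ℝ (f - u l) (p - z) ≤ ε ^ 2 / 2 := by
    rw [dist_eq_norm] at hpz
    calc _ ≤ ‖f - u l‖ * ‖p - z‖ := real_inner_le_norm _ _
      _ ≤ (K + 1) * (ε ^ 2 / (2 * (K + 1))) := by gcongr; linarith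
      _ = ε ^ 2 / 2 := by field_simp
  have h₈ : ‖u l - p‖ ^ 2 =
      inner ℝ (f - u l) (p - z) + inner ℝ (f - u l) (z - u l) + inner ℝ (f - p) (u l - p) := by
    rw [← real_inner_self_eq_norm_sq]
    simp only [inner_sub_left, inner_sub_right, real_inner_comm p (u l)]
    ring
  rw [dist_zero_right, norm_norm]
  exact lt_of_pow_lt_pow_left₀ 2 hε.le (by linarith)

/-- The closure of the domain of a monotone operator `A` is convex if `1 + l A` is onto for every
`l > 0`. -/
theorem MultiOp.IsMonotone.closure_dom_eq {A : MultiOp H} (hA : A.IsMonotone)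
    {J : ℝ≥0 → H → H} (hJ : ∀ l, 0 < l → ∀ f, (l : ℝ)⁻¹ • (f - J l f) ∈ A (J l f)) :
    closure A.dom = closure (convexHull ℝ A.dom) := by
  refine (closure_mono (subset_convexHull ℝ _)).antisymm fun f hf => ?_
  have := tendsto_iff_norm_sub_tendsto_zero.2
    (hA.tendsto_resolvent (u := fun l => J l f) (fun l hl => hJ l hl f) hf (by simp))
  refine mem_closure_of_tendsto this ?_
  filter_upwards [self_mem_nhdsWithin] with l hl
  exact ⟨_, hJ l hl f⟩

/-- The resolvents of a monotone operator form a strongly continuous non-expansive resolvent. -/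
theorem MultiOp.IsMonotone.isResolvent {A : MultiOp H} (hA : A.IsMonotone) {J : ℝ≥0 → H → H}
    (hJ : ∀ l : ℝ≥0, 0 < l → MultiOp.ofFun (J l) = (A.idAddSMul (l : ℝ)).inverse)
    (h₀ : ∀ f, IsProjection (closure A.dom) f (J 0 f)) : IsResolvent (closure A.dom) J := by
  have hJ' : ∀ l : ℝ≥0, 0 < l → ∀ x g, g ∈ A x → J l (x + (l : ℝ) • g) = x := by
    intro l hl x g hg
    have : x ∈ (A.idAddSMul (l : ℝ)).inverse (x + (l : ℝ) • g) := ⟨g, hg, rfl⟩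
    rw [← hJ l hl] at this
    exact Eq.symm this
  have hJA : ∀ l : ℝ≥0, 0 < l → ∀ f, (l : ℝ)⁻¹ • (f - J l f) ∈ A (J l f) := by
    intro l hl f
    have : J l f ∈ MultiOp.ofFun (J l) f := rfl
    rw [hJ l hl] at this
    obtain ⟨g, hg, h⟩ := this
    have hl' : (l : ℝ) ≠ 0 := by exact_mod_cast hl.ne'
    dsimp only at h
    have : (l : ℝ)⁻¹ • (f - J l f) = g := by
      rw [sub_eq_of_eq_add' h.symm, inv_smul_smul₀ hl']
    rwa [this]
  have hconv : Convex ℝ (closure A.dom) := by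
    rw [hA.closure_dom_eq hJA]
    exact (convex_convexHull ℝ _).closure
  have hmem : ∀ l : ℝ≥0, 0 < l → ∀ f, J l f ∈ closure A.dom := fun l hl f =>
    subset_closure ⟨_, hJA l hl f⟩
  refine ⟨⟨_, hmem 1 one_pos 0⟩, isClosed_closure, hconv, h₀, ?_, ?_, ?_⟩
  · intro l m hl f
    rcases eq_or_ne m 0 with rfl | hm
    · simpa using ((h₀ (J l f)).eq_self (hmem l hl f)).symm
    · have := hJ' m (pos_iff_ne_zero.2 hm) _ _ (hJA l hl f)
      rw [← this]
      congr 1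
      rw [this]
      module
  · intro f p hp
    refine hA.tendsto_resolvent (fun l hl => hJA l hl f) ?_
      fun w hw => hp.inner_le_zero hconv (subset_closure hw)
    rw [← hA.closure_dom_eq hJA]
    exact hp.1
  · intro l f g
    rcases eq_or_ne l 0 with rfl | hl
    · exact (h₀ f).norm_sub_le hconv (h₀ g)
    · have hl' : (l : ℝ) ≠ 0 := by exact_mod_cast hl
      have := hA.norm_sub_le l.coe_nonneg (hJA l (pos_iff_ne_zero.2 hl) f) (hJA l (pos_iff_ne_zero.2 hl) g)
      simpa only [smul_inv_smul₀ hl', add_sub_cancel] using this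

/-- The generator of a family of maps `J`: the operator `A` whose graph consists of the pairs
`(x, g)` with `J_l (x + l g) = x` for all `l > 0`. -/
def generator (J : ℝ≥0 → H → H) : MultiOp H :=
  fun x => {g | ∀ l : ℝ≥0, 0 < l → J l (x + (l : ℝ) • g) = x}

namespace IsResolvent

variable {C : Set H} {J : ℝ≥0 → H → H}

theorem mem_generator (hJ : IsResolvent C J) {l : ℝ≥0} (hl : 0 < l) (f : H) :
    (l : ℝ)⁻¹ • (f - J l f) ∈ generator J (J l f) := by
  intro m _
  conv_rhs => rw [hJ.resolvent_identity l m hl f]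
  congr 1
  module

theorem isMonotone_generator (hJ : IsResolvent C J) : (generator J).IsMonotone := by
  intro x y g h hg hh
  have key : ∀ l : ℝ≥0, 0 < l →
      0 ≤ 2 * inner ℝ (g - h) (x - y) + (l : ℝ) * ‖g - h‖ ^ 2 := by
    intro l hl
    have h₁ := hJ.nonexpansive l (x + (l : ℝ) • g) (y + (l : ℝ) • h)
    rw [hg l hl, hh l hl,
      show (x + (l : ℝ) • g) - (y + (l : ℝ) • h) = (x - y) + (l : ℝ) • (g - h) by module] at h₁
    have h₂ := pow_le_pow_left₀ (norm_nonneg _) h₁ 2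
    rw [norm_add_sq_real, real_inner_smul_right, norm_smul, Real.norm_of_nonneg l.coe_nonneg,
      real_inner_comm] at h₂
    have hl' : (0 : ℝ) < l := hl
    refine nonneg_of_mul_nonneg_right (a := (l : ℝ)) ?_ hl'
    linarith
  have hlim : Tendsto (fun l : ℝ≥0 => 2 * inner ℝ (g - h) (x - y) + (l : ℝ) * ‖g - h‖ ^ 2)
      (𝓝[>] 0) (𝓝 (2 * inner ℝ (g - h) (x - y))) := by
    have : Continuous fun l : ℝ≥0 =>
        2 * inner ℝ (g - h) (x - y) + (l : ℝ) * ‖g - h‖ ^ 2 := by fun_prop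
    simpa using (this.tendsto 0).mono_left nhdsWithin_le_nhds
  have := ge_of_tendsto hlim (eventually_nhdsWithin_of_forall key)
  linarith

theorem isMaximalMonotone_generator (hJ : IsResolvent C J) :
    (generator J).IsMaximalMonotone :=
  hJ.isMonotone_generator.isMaximalMonotone fun f =>
    ⟨J 1 f, by simpa using hJ.mem_generator one_pos f⟩

theorem ofFun_eq (hJ : IsResolvent C J) {l : ℝ≥0} (hl : 0 < l) :
    MultiOp.ofFun (J l) = ((generator J).idAddSMul (l : ℝ)).inverse := by
  have hl' : (l : ℝ) ≠ 0 := by exact_mod_cast hl.ne'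
  funext f
  ext x
  constructor
  · rintro rfl
    refine ⟨_, hJ.mem_generator hl f, ?_⟩
    simp only [smul_inv_smul₀ hl', add_sub_cancel]
  · rintro ⟨g, hg, rfl⟩
    exact (hg l hl).symm

theorem closure_dom_generator (hJ : IsResolvent C J) : closure (generator J).dom = C := by
  refine (closure_minimal ?_ hJ.isClosed).antisymm fun f hf => ?_
  · rintro x ⟨g, hg⟩
    have h₁ := hJ.resolvent_identity 1 0 one_pos (x + ((1 : ℝ≥0) : ℝ) • g)
    rw [hg 1 one_pos] at h₁
    rw [h₁]
    exact (hJ.identity _).1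
  · have hproj : IsProjection C f f := ⟨hf, by simp⟩
    refine mem_closure_of_tendsto
      (tendsto_iff_norm_sub_tendsto_zero.2 (hJ.strong_continuity f f hproj)) ?_
    filter_upwards [self_mem_nhdsWithin] with l hl
    exact ⟨_, hJ.mem_generator hl f⟩

theorem isClosed_graph_generator (hJ : IsResolvent C J) : IsClosed (generator J).graph := by
  have : (generator J).graph =
      ⋂ (l : ℝ≥0) (_ : 0 < l), {q : H × H | J l (q.1 + (l : ℝ) • q.2) = q.1} := by
    ext q
    simp [MultiOp.graph, generator]
  rw [this]
  refine isClosed_iInter fun l => isClosed_iInter fun _ => isClosed_eq ?_ continuous_fst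
  have hc : Continuous (J l) := (LipschitzWith.of_dist_le_mul (K := 1) fun f g => by
    simpa [dist_eq_norm] using hJ.nonexpansive l f g).continuous
  fun_prop

theorem graphTendsto (hJ : IsResolvent C J) :
    GraphTendsto (approxGenerator J) (𝓝[>] 0) (generator J) := by
  refine pkTendsto_of_subset ?_ ?_
  · rintro ⟨x, g⟩ hg
    have hlim : Tendsto (fun l : ℝ≥0 => edist (x, g) (x + (l : ℝ) • g, g)) (𝓝[>] 0) (𝓝 0) := by
      have : Continuous fun l : ℝ≥0 => edist (x, g) (x + (l : ℝ) • g, g) := by fun_prop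
      simpa using (this.tendsto 0).mono_left nhdsWithin_le_nhds
    refine tendsto_of_tendsto_of_tendsto_of_le_of_le' tendsto_const_nhds hlim
      (Eventually.of_forall fun _ => bot_le) ?_
    filter_upwards [self_mem_nhdsWithin] with l hl
    refine Metric.infEDist_le_edist_of_mem ?_
    have hl' : (l : ℝ) ≠ 0 := by exact_mod_cast (ne_of_gt hl)
    change g = (l : ℝ)⁻¹ • (x + (l : ℝ) • g - J l (x + (l : ℝ) • g))
    rw [hg l hl, add_sub_cancel_left, inv_smul_smul₀ hl']
  · rintro ⟨x, g⟩ hxg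
    set S : Set ((H × H) × ℝ≥0) :=
      (fun q => (q.1.1 - (q.2 : ℝ) • q.1.2, q.1.2)) ⁻¹' (generator J).graph
    have hS : IsClosed S := hJ.isClosed_graph_generator.preimage (by fun_prop)
    suffices h : ((x, g), (0 : ℝ≥0)) ∈ S by simpa [S] using h
    rw [← hS.closure_eq, EMetric.mem_closure_iff]
    intro ε hε
    have h₁ : ∃ᶠ l in 𝓝[>] (0 : ℝ≥0),
        Metric.infEDist (x, g) (approxGenerator J l).graph < ε :=
      frequently_lt_of_liminf_lt (by isBoundedDefault) (lt_of_eq_of_lt hxg hε)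
    have h₂ : ∀ᶠ l in 𝓝[>] (0 : ℝ≥0), edist 0 l < ε := by
      have : Continuous fun l : ℝ≥0 => edist 0 l := by fun_prop
      refine nhdsWithin_le_nhds ((this.tendsto 0).eventually_lt_const ?_)
      simpa using hε
    obtain ⟨l, hl, hlε, hl0⟩ := (h₁.and_eventually (h₂.and self_mem_nhdsWithin)).exists
    obtain ⟨⟨a, b⟩, hab, hd⟩ := Metric.infEDist_lt_iff.1 hl
    refine ⟨((a, b), l), ?_, by rw [Prod.edist_eq]; exact max_lt hd hlε⟩
    obtain rfl : b = (l : ℝ)⁻¹ • (a - J l a) := hab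
    have hl' : (l : ℝ) ≠ 0 := by exact_mod_cast (ne_of_gt hl0)
    have : (J l a, (l : ℝ)⁻¹ • (a - J l a)) ∈ (generator J).graph :=
      hJ.mem_generator hl0 a
    simpa only [S, Set.mem_preimage, smul_inv_smul₀ hl', sub_sub_cancel] using this

end IsResolvent

end

end NonlinearResolvent

theorem mainTheorem6 {H : Type*} [NormedAddCommGroup H] [InnerProductSpace ℝ H] [CompleteSpace H]
    (C : Set H) (J : ℝ≥0 → H → H) :
    NonlinearResolvent.IsResolvent C J ↔
      ∃ A : NonlinearResolvent.MultiOp H,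
        A.IsMaximalMonotone ∧
        NonlinearResolvent.GraphTendsto (NonlinearResolvent.approxGenerator J) (𝓝[>] 0) A ∧
        (∀ l : ℝ≥0, 0 < l →
          NonlinearResolvent.MultiOp.ofFun (J l) = (A.idAddSMul (l : ℝ)).inverse) ∧
        closure A.dom = C ∧
        ∀ f, NonlinearResolvent.IsProjection C f (J 0 f) := by
  constructor
  · intro h
    exact ⟨_, h.isMaximalMonotone_generator, h.graphTendsto, fun l hl => h.ofFun_eq hl,
      h.closure_dom_generator, h.identity⟩
  · rintro ⟨A, hA, -, hJ, rfl, h₀⟩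
    exact hA.1.isResolvent hJ h₀
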